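/- Let $U(L(sl_2))$ be the enveloping algebra over $\mathbb{C}$ of the $sl_2$ loop algebra, with generators $x_k^{\pm}, h_k$ ($k\in\mathbb{Z}$) satisfying $[h_j,x_k^{\pm}]=\pm 2x_{j+k}^{\pm}$, $[x_j^{+},x_k^{-}]=h_{j+k}$, $[h_j,h_k]=0$, $[x_j^{\pm},x_k^{\pm}]=0$. Let $U(B)$ be the subalgebra generated by $h_0, x_0^{+}, x_1^{-}$; it contains $h_k, x_k^{+}$ for $k\ge 0$ and $x_k^{-}$ for $k\ge 1$. Let $\Psi\neq 0$ be a vector of a $U(B)$-module with $x_k^{+}\Psi=0$ and $h_k\Psi=d_k\Psi$ for all $k\ge 0$ ($d_k\in\mathbb{C}$), and assume that $V_B=U(B)\Psi$ is finite-dimensional over $\mathbb{C}$. Let $r\ge 0$ be the degree of nilpotency of $x_1^{-}$ in $V_B$, i.e. $(x_1^{-})^{r+1}\Psi=0$ and $(x_1^{-})^{j}\Psi\ne 0$ for $0<j\le r$. Let $\lambda_k\in\mathbb{C}$ be the eigenvalue defined by $\frac{(x_0^{+})^k}{k!}\frac{(x_1^{-})^k}{k!}\Psi=\lambda_k\Psi$,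 and put $P_\Psi(u)=\sum_{k=0}^{r}\lambda_k(-u)^k$. The evaluation parameters of $\Psi$ are pairwise different $a_1,\dots,a_s\in\mathbb{C}$, with multiplicities $m_1,\dots,m_s\ge 1$, such that $P_\Psi(u)=\prod_{k=1}^{s}(1-a_ku)^{m_k}$ and $m_1+\dots+m_s=r$. For a multiset $A$ of $m$ complex parameters let $x_m^{-}(A)=\sum_{k=0}^{m}(-1)^k e_k(A)\,x_{m-k}^{-}$, where $e_k$ is the $k$-th elementary symmetric function, and for $1\le j\le s$ let $\rho_j^{-}(\boldsymbol{a}^{(1)})=x_s^{-}(A_j^{(1)})$ with $A_j^{(1)}=\{a_1,\dots,a_s\}\setminus\{a_j\}\cup\{0\}$ (multiset union); the coefficient of $x_0^{-}$ is zero, so this is an element of $U(B)$. If the evaluation parameters, counted with multiplicity, are distinct, i.e. $m_k=1$ for all $k$ (so $s=r$), then for every integer $n\ge 0$ the vectors $\prod_{t=1}^{n}\rho_{j_t}^{-}(\boldsymbol{a}^{(1)})\,\Psi$, indexed by $1\le j_1<\dots<j_n\le s$, form a basis of the sector $\{v\in V_B : h_0v=(d_0-2n)v\}$. -/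

import Mathlib

open scoped TensorProduct Nat

noncomputable section

namespace BorelLoop

/-- The Lie algebra `sl₂` over `ℂ`. -/
abbrev Sl2 := LieAlgebra.SpecialLinear.sl (Fin 2) ℂ

/-- The `sl₂` loop algebra `L(sl₂) = ℂ[t, t⁻¹] ⊗ sl₂`. -/
abbrev LoopSl2 := LieAlgebra.loopAlgebra ℂ ℤ Sl2

/-- The enveloping algebra `U(L(sl₂))`. -/
abbrev ULoop := UniversalEnvelopingAlgebra ℂ LoopSl2

/-- The standard raising matrix of `sl₂`. -/
def matE : Sl2 := LieAlgebra.SpecialLinear.single (0 : Fin 2) 1 (by decide) (1 : ℂ)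

/-- The standard lowering matrix of `sl₂`. -/
def matF : Sl2 := LieAlgebra.SpecialLinear.single (1 : Fin 2) 0 (by decide) (1 : ℂ)

/-- The diagonal matrix `diag(1, -1)` of `sl₂`. -/
def matH : Sl2 := LieAlgebra.SpecialLinear.singleSubSingle (0 : Fin 2) 1 (1 : ℂ)

/-- The image in `U(L(sl₂))` of `t ^ k ⊗ y`. -/
def loopGen (y : Sl2) (k : ℤ) : ULoop :=
  UniversalEnvelopingAlgebra.ι ℂ
    ((AddMonoidAlgebra.single k (1 : ℂ) ⊗ₜ[ℂ] y : LoopSl2))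

/-- The Drinfeld generator `x_k⁺` (`k ∈ ℤ`) of `U(L(sl₂))`. -/
def xPlus (k : ℤ) : ULoop := loopGen matE k

/-- The Drinfeld generator `x_k⁻`. -/
def xMinus (k : ℤ) : ULoop := loopGen matF k

/-- The Drinfeld generator `h_k`. -/
def hGen (k : ℤ) : ULoop := loopGen matH k

/-- The Borel subalgebra `U(B)`: the subalgebra of `U(L(sl₂))` generated by `h_0`, `x_0⁺` and
`x_1⁻`. -/
def UB : Subalgebra ℂ ULoop := Algebra.adjoin ℂ {hGen 0, xPlus 0, xMinus 1}

/-! The defining relations of the generators. -/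

theorem lie_matE_matF : ⁅matE, matF⁆ = matH := by
  apply Subtype.ext
  rw [LieAlgebra.SpecialLinear.sl_bracket]
  ext i j
  fin_cases i <;> fin_cases j <;> simp [matE, matF, matH]

theorem lie_matH_matE : ⁅matH, matE⁆ = (2 : ℂ) • matE := by
  apply Subtype.ext
  rw [LieAlgebra.SpecialLinear.sl_bracket]
  ext i j
  fin_cases i <;> fin_cases j <;> simp [matE, matH, Matrix.sub_mul, Matrix.mul_sub] <;> norm_num

theorem lie_matH_matF : ⁅matH, matF⁆ = (-2 : ℂ) • matF := by
  apply Subtype.ext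
  rw [LieAlgebra.SpecialLinear.sl_bracket]
  ext i j
  fin_cases i <;> fin_cases j <;> simp [matF, matH, Matrix.sub_mul, Matrix.mul_sub] <;> norm_num

section

attribute [local instance 100] LieRing.ofAssociativeRing

theorem loopGen_comm (y z : Sl2) (j k : ℤ) :
    loopGen y j * loopGen z k - loopGen z k * loopGen y j = loopGen ⁅y, z⁆ (j + k) := by
  rw [← LieRing.of_associative_ring_bracket, loopGen, loopGen, ← LieHom.map_lie,
    LieAlgebra.ExtendScalars.bracket_tmul, AddMonoidAlgebra.single_mul_single, one_mul, loopGen]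

theorem loopGen_smul (c : ℂ) (y : Sl2) (k : ℤ) : loopGen (c • y) k = c • loopGen y k := by
  rw [loopGen, TensorProduct.tmul_smul, map_smul, loopGen]

theorem loopGen_zero (k : ℤ) : loopGen 0 k = 0 := by
  rw [loopGen, TensorProduct.tmul_zero, map_zero]

end

theorem xPlus_xMinus_comm (j k : ℤ) :
    xPlus j * xMinus k - xMinus k * xPlus j = hGen (j + k) := by
  rw [xPlus, xMinus, loopGen_comm, lie_matE_matF, hGen]

theorem hGen_xPlus_comm (j k : ℤ) :
    hGen j * xPlus k - xPlus k * hGen j = (2 : ℂ) • xPlus (j + k) := by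
  rw [xPlus, hGen, loopGen_comm, lie_matH_matE, loopGen_smul, xPlus]

theorem hGen_xMinus_comm (j k : ℤ) :
    hGen j * xMinus k - xMinus k * hGen j = (-2 : ℂ) • xMinus (j + k) := by
  rw [xMinus, hGen, loopGen_comm, lie_matH_matF, loopGen_smul, xMinus]

theorem hGen_comm (j k : ℤ) : hGen j * hGen k - hGen k * hGen j = 0 := by
  rw [hGen, hGen, loopGen_comm, lie_self, loopGen_zero]

theorem xPlus_comm (j k : ℤ) : xPlus j * xPlus k - xPlus k * xPlus j = 0 := by
  rw [xPlus, xPlus, loopGen_comm, lie_self, loopGen_zero]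

theorem xMinus_comm (j k : ℤ) : xMinus j * xMinus k - xMinus k * xMinus j = 0 := by
  rw [xMinus, xMinus, loopGen_comm, lie_self, loopGen_zero]

/-! The generators `h_k`, `x_k⁺` (`k ≥ 0`) and `x_k⁻` (`k ≥ 1`) lie in `U(B)`. -/

theorem xPlus_zero_mem : xPlus 0 ∈ UB := Algebra.subset_adjoin (by simp)

theorem hGen_zero_mem : hGen 0 ∈ UB := Algebra.subset_adjoin (by simp)

theorem xMinus_one_mem : xMinus 1 ∈ UB := Algebra.subset_adjoin (by simp)

theorem xMinus_mem_succ (n : ℕ) (hh : hGen 1 ∈ UB) : xMinus ((n : ℤ) + 1) ∈ UB := by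
  induction n with
  | zero => simpa using xMinus_one_mem
  | succ n ih =>
    have h1 := hGen_xMinus_comm 1 ((n : ℤ) + 1)
    have h2 : xMinus (((n + 1 : ℕ) : ℤ) + 1) = (-2 : ℂ)⁻¹ •
        (hGen 1 * xMinus ((n : ℤ) + 1) - xMinus ((n : ℤ) + 1) * hGen 1) := by
      rw [h1, smul_smul, inv_mul_cancel₀ (by norm_num), one_smul]
      congr 1
      push_cast
      ring
    rw [h2]
    exact UB.smul_mem (sub_mem (mul_mem hh ih) (mul_mem ih hh)) _

theorem hGen_one_mem : hGen 1 ∈ UB := by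
  have h := xPlus_xMinus_comm 0 1
  rw [zero_add] at h
  rw [← h]
  exact sub_mem (mul_mem xPlus_zero_mem xMinus_one_mem) (mul_mem xMinus_one_mem xPlus_zero_mem)

theorem xMinus_mem (k : ℕ) (hk : 1 ≤ k) : xMinus k ∈ UB := by
  obtain ⟨n, rfl⟩ := Nat.exists_eq_add_of_le' hk
  simpa using xMinus_mem_succ n hGen_one_mem

theorem xPlus_mem (k : ℕ) : xPlus k ∈ UB := by
  induction k with
  | zero => simpa using xPlus_zero_mem
  | succ n ih =>
    have h1 := hGen_xPlus_comm 1 (n : ℤ)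
    have h2 : xPlus ((n + 1 : ℕ) : ℤ) = (2 : ℂ)⁻¹ •
        (hGen 1 * xPlus (n : ℤ) - xPlus (n : ℤ) * hGen 1) := by
      rw [h1, smul_smul, inv_mul_cancel₀ (by norm_num), one_smul]
      congr 1
      push_cast
      ring
    rw [h2]
    exact UB.smul_mem (sub_mem (mul_mem hGen_one_mem ih) (mul_mem ih hGen_one_mem)) _

theorem hGen_mem (k : ℕ) : hGen k ∈ UB := by
  rcases Nat.eq_zero_or_pos k with rfl | hk
  · simpa using hGen_zero_mem
  · have h := xPlus_xMinus_comm 0 (k : ℤ)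
    rw [zero_add] at h
    rw [← h]
    exact sub_mem (mul_mem xPlus_zero_mem (xMinus_mem k hk))
      (mul_mem (xMinus_mem k hk) xPlus_zero_mem)

/-- `x_k⁺` (`k ≥ 0`) as an element of `U(B)`. -/
def bxPlus (k : ℕ) : UB := ⟨xPlus k, xPlus_mem k⟩

/-- `h_k` (`k ≥ 0`) as an element of `U(B)`. -/
def bh (k : ℕ) : UB := ⟨hGen k, hGen_mem k⟩

/-- `x_1⁻` as an element of `U(B)`. -/
def bxMinusOne : UB := ⟨xMinus 1, xMinus_one_mem⟩

/-- The generator with parameters `x_m⁻(A)`, where `A` is a multiset of `m` parameters: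
`∑_{k=0}^m (-1)^k e_k(A) x_{m-k}⁻` with `e_k` the elementary symmetric functions. -/
def xMinusParam (A : Multiset ℂ) : ULoop :=
  ∑ k ∈ Finset.range (Multiset.card A + 1),
    ((-1 : ℂ) ^ k * A.esymm k) • xMinus ((Multiset.card A : ℤ) - k)

/-- If `0` is among the parameters, then `x_m⁻(A)` does not involve `x_0⁻` and lies in `U(B)`. -/
theorem xMinusParam_mem (A : Multiset ℂ) (hA : (0 : ℂ) ∈ A) : xMinusParam A ∈ UB := by
  refine sum_mem fun k hk => ?_
  rcases Nat.lt_or_ge k (Multiset.card A) with h | h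
  · have h2 : ((Multiset.card A : ℤ) - k) = ((Multiset.card A - k : ℕ) : ℤ) := by omega
    rw [h2]
    exact UB.smul_mem (xMinus_mem _ (by omega)) _
  · have h3 : k = Multiset.card A := by
      have := Finset.mem_range.1 hk
      omega
    have h4 : A.esymm k = 0 := by
      subst h3
      simp [Multiset.esymm, Multiset.powersetCard_self, Multiset.prod_eq_zero hA]
    rw [h4, mul_zero, zero_smul]
    exact zero_mem _

/-- The multiset `A_j⁽¹⁾ = {α_1, …, α_s} ∖ {α_j} ∪ {0}`. -/
def paramsWithout {s : ℕ} (α : Fin s → ℂ) (j : Fin s) : Multiset ℂ :=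
  0 ::ₘ ((Finset.univ.erase j).val.map α)

/-- `ρ_j⁻(α⁽¹⁾) = x_s⁻(A_j⁽¹⁾)`, an element of `U(B)`. -/
def rhoMinus {s : ℕ} (α : Fin s → ℂ) (j : Fin s) : UB :=
  ⟨xMinusParam (paramsWithout α j), xMinusParam_mem _ (Multiset.mem_cons_self _ _)⟩

/-- The divided power `X⁽ⁿ⁾ = Xⁿ / n!`. -/
def dividedPow (X : UB) (n : ℕ) : UB := ((n ! : ℂ)⁻¹) • X ^ n

variable {V : Type*} [AddCommGroup V] [Module ℂ V] [Module UB V] [IsScalarTower ℂ UB V]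

/-- `Ψ` is a highest weight vector of `U(B)` with highest weight `(d_k)`. -/
structure IsHighestWeightVector (d : ℕ → ℂ) (Ψ : V) : Prop where
  ne_zero : Ψ ≠ 0
  xPlus_smul : ∀ k : ℕ, bxPlus k • Ψ = 0
  h_smul : ∀ k : ℕ, bh k • Ψ = d k • Ψ

/-- The representation `V_B = U(B) Ψ` generated by `Ψ`, as a complex vector space. -/
def VB (Ψ : V) : Submodule ℂ V := (Submodule.span UB {Ψ}).restrictScalars ℂ

/-- The sector `h_0 = d_0 - 2n` of `V_B`. -/
def sector (Ψ : V) (d₀ : ℂ) (n : ℕ) : Submodule ℂ V where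
  carrier := {v | v ∈ VB Ψ ∧ bh 0 • v = (d₀ - 2 * (n : ℂ)) • v}
  zero_mem' := ⟨zero_mem _, by rw [smul_zero, smul_zero]⟩
  add_mem' := fun ha hb => ⟨add_mem ha.1 hb.1, by rw [smul_add, smul_add, ha.2, hb.2]⟩
  smul_mem' := fun c v hv => ⟨(VB Ψ).smul_mem c hv.1, by
    rw [← algebraMap_smul UB c v, smul_smul, ← Algebra.commutes, ← smul_smul, hv.2,
      algebraMap_smul, algebraMap_smul, smul_comm]⟩

/-- `x_1⁻` is nilpotent of degree `r` in `V_B = U(B) Ψ`. -/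
def IsNilpotentOfDegree (Ψ : V) (r : ℕ) : Prop :=
  bxMinusOne ^ (r + 1) • Ψ = 0 ∧ ∀ j : ℕ, 0 < j → j ≤ r → bxMinusOne ^ j • Ψ ≠ 0

open Classical in
/-- The eigenvalue `λ_k` of `(x_0⁺)⁽ᵏ⁾ (x_1⁻)⁽ᵏ⁾` on `Ψ` (with the value `0` if `Ψ` is not an
eigenvector, which does not happen for a highest weight vector). -/
def eigenvalue (Ψ : V) (k : ℕ) : ℂ :=
  if h : ∃ c : ℂ, (dividedPow (bxPlus 0) k * dividedPow bxMinusOne k) • Ψ = c • Ψ then h.choose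
  else 0

open Polynomial in
/-- The generalized Drinfeld polynomial `P_Ψ(u) = ∑_{k=0}^r λ_k (-u)^k`, where `r` is the degree
of nilpotency of `x_1⁻`. -/
def drinfeldPoly (Ψ : V) (r : ℕ) : ℂ[X] :=
  ∑ k ∈ Finset.range (r + 1), C (eigenvalue Ψ k) * (-X) ^ k

open Polynomial in
/-- `a_1, …, a_s` are the (pairwise different) evaluation parameters of `Ψ`, with multiplicities
`m_1, …, m_s ≥ 1`: `P_Ψ(u) = ∏_k (1 - a_k u)^{m_k}` and `m_1 + ⋯ + m_s = r`. The last condition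
fixes the multiplicity of a possible parameter `a_k = 0`, which the product does not see. -/
structure IsEvaluationParameters (Ψ : V) (r : ℕ) {s : ℕ} (a : Fin s → ℂ) (m : Fin s → ℕ) :
    Prop where
  injective : Function.Injective a
  mult_pos : ∀ k, 0 < m k
  sum_mult : ∑ k, m k = r
  factorization : drinfeldPoly Ψ r = ∏ k, (1 - C (a k) * X) ^ m k

end BorelLoop

end

/-!
Let `Y(u) = ∑ uⁱ x⁻_{i+1}` and `Λ(u) = exp (-∑ d_n uⁿ / n)`, so that `Λ' = -DΛ` where
`D(u) = ∑ d_{i+1} uⁱ`. On power series applied to `Ψ`, the element `x_0⁺` sends `Y^{m+1} Λ` to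
`-(m+1) (Y^m Λ)'`; hence `(x_0⁺)^k (x_1⁻)^{m+k} Ψ` is a nonzero multiple of the coefficient of `u^k`
in `Y^m Λ Ψ`. The case `m = 0` identifies `Λ` with `P_Ψ` up to degree `r`.

Since `(x_1⁻)^{r+1} Ψ = 0`, the case `m = 1`, `k = r` gives `(t ∏ (t - a_i) ⊗ x⁻) Ψ = 0`, and
bracketing with the `h_k` extends this to all multiples of the polynomial: `t f(t) ⊗ x⁻` acts on `Ψ`
through the values `f(a_i)`, so by Lagrange interpolation as a combination of the `ρ_j`. The case
`m = 2`, `k = r - 1` then becomes `∑ w_j ρ_j² Ψ = 0` with the nodal weights `w_j`, whose terms the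
`h_k` separate: `ρ_j² Ψ = 0`.

Hence the vectors `ρ_S Ψ = ∏_{j ∈ S} ρ_j Ψ` span `V_B`, and `h_0` acts on `ρ_S Ψ` by `d_0 - 2 |S|`.
As `(x_1⁻)^r Ψ ≠ 0` is a multiple of the product over all `j`, that product does not vanish, and
multiplying a linear relation by complementary products shows that the `ρ_S Ψ` are independent.
-/

noncomputable section

namespace BorelLoop

open PowerSeries Finset Lagrange

open scoped Polynomial

section FormalDerivative

variable {A : Type*} [Semiring A]

/-- The formal derivative of a power series, over a ring that need not be commutative (unlike
`PowerSeries.derivative`). -/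
def formalDeriv (f : A⟦X⟧) : A⟦X⟧ := mk fun n => (n + 1) • coeff (n + 1) f

theorem coeff_formalDeriv (n : ℕ) (f : A⟦X⟧) :
    coeff n (formalDeriv f) = (n + 1) • coeff (n + 1) f := coeff_mk _ _

theorem formalDeriv_one : formalDeriv (1 : A⟦X⟧) = 0 := by
  ext n
  rw [coeff_formalDeriv, coeff_one, if_neg n.succ_ne_zero, smul_zero, map_zero]

theorem formalDeriv_mul (f g : A⟦X⟧) :
    formalDeriv (f * g) = formalDeriv f * g + f * formalDeriv g := by
  ext n
  have split_weight : ∀ p ∈ antidiagonal (n + 1), (n + 1) • (coeff p.1 f * coeff p.2 g) =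
      p.1 • (coeff p.1 f * coeff p.2 g) + p.2 • (coeff p.1 f * coeff p.2 g) := fun p hp => by
    rw [← add_smul, mem_antidiagonal.1 hp]
  rw [coeff_formalDeriv, coeff_mul, smul_sum, sum_congr rfl split_weight, sum_add_distrib,
    Nat.sum_antidiagonal_succ, Nat.sum_antidiagonal_succ', map_add, coeff_mul, coeff_mul]
  simp only [coeff_formalDeriv, zero_smul, zero_add, smul_mul_assoc, mul_smul_comm]

theorem formalDeriv_pow_succ {f : A⟦X⟧} (hf : Commute (formalDeriv f) f) (n : ℕ) :
    formalDeriv (f ^ (n + 1)) = (n + 1) • (f ^ n * formalDeriv f) := by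
  induction n with
  | zero => rw [zero_add, pow_one, pow_zero, one_mul, one_smul]
  | succ n ih =>
    rw [pow_succ, formalDeriv_mul, ih, smul_mul_assoc, mul_assoc, hf.eq, ← mul_assoc, ← pow_succ,
      ← succ_nsmul]

theorem formalDeriv_map {R : Type*} [CommSemiring R] (g : R →+* A) (f : R⟦X⟧) :
    formalDeriv (PowerSeries.map g f) = PowerSeries.map g (d⁄dX R f) := by
  ext n
  rw [coeff_formalDeriv, coeff_map, coeff_map, coeff_derivative, map_mul, map_add, map_natCast,
    map_one, ← Nat.cast_succ, ← Nat.cast_comm, nsmul_eq_mul]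

theorem commute_of_coeff {f g : A⟦X⟧} (h : ∀ i j, Commute (coeff i f) (coeff j g)) :
    Commute f g := by
  ext n
  rw [coeff_mul, coeff_mul, ← Nat.sum_antidiagonal_swap]
  exact sum_congr rfl fun _ _ => h _ _

theorem commute_map_algebraMap {R : Type*} [CommSemiring R] [Algebra R A] (f : R⟦X⟧) (g : A⟦X⟧) :
    Commute (PowerSeries.map (algebraMap R A) f) g :=
  commute_of_coeff fun i j => by
    rw [coeff_map]
    exact Algebra.commutes _ _

end FormalDerivative

section SeriesAnnihilator

variable {A V : Type*} [Semiring A] [AddCommMonoid V] [Module A V]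

/-- The left ideal of the power series all of whose coefficients annihilate `Ψ`. -/
def seriesAnnihilator (Ψ : V) : Ideal A⟦X⟧ where
  carrier := {f | ∀ n, coeff n f • Ψ = 0}
  zero_mem' n := by rw [map_zero, zero_smul]
  add_mem' hf hg n := by rw [map_add, add_smul, hf, hg, add_zero]
  smul_mem' g f hf n := by
    rw [smul_eq_mul, coeff_mul, sum_smul]
    exact sum_eq_zero fun p _ => by rw [mul_smul, hf, smul_zero]

end SeriesAnnihilator

/-- Elements `e`, `F f`, `H f` of an algebra that satisfy the relations of `x_0⁺`,
`t f(t) ⊗ x⁻` and `f(t) ⊗ h` in the enveloping algebra of the `sl₂` loop algebra. -/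
structure LoopTriple (R A : Type*) [CommRing R] [Ring A] [Algebra R A] where
  /-- The raising element `x_0⁺`. -/
  e : A
  /-- The lowering elements `t f(t) ⊗ x⁻`; in particular `x_{k+1}⁻ = F (X ^ k)`. -/
  F : R[X] →ₗ[R] A
  /-- The diagonal elements `f(t) ⊗ h`. -/
  H : R[X] →ₗ[R] A
  F_comm : ∀ f g, Commute (F f) (F g)
  e_F : ∀ f, e * F f = F f * e + H (Polynomial.X * f)
  H_F : ∀ f g, H f * F g = F g * H f - (2 : R) • F (f * g)

namespace LoopTriple

section Series

variable {R A V : Type*} [CommRing R] [Ring A] [Algebra R A] [AddCommGroup V] [Module A V]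
  (T : LoopTriple R A)

/-- `Ψ` is a highest weight vector, of weight given by the functional `δ`. -/
structure IsHighest [Module R V] (δ : R[X] →ₗ[R] R) (Ψ : V) : Prop where
  e_smul : T.e • Ψ = 0
  H_smul : ∀ f, T.H f • Ψ = δ f • Ψ

/-- The generating series of the lowering elements `x_{i+1}⁻`. -/
def fSeries : A⟦X⟧ := PowerSeries.mk fun i => T.F (Polynomial.X ^ i)

/-- The generating series of the diagonal elements `h_{i+1}`. -/
def hSeries : A⟦X⟧ := PowerSeries.mk fun i => T.H (Polynomial.X ^ (i + 1))

theorem commute_formalDeriv_fSeries : Commute (formalDeriv T.fSeries) T.fSeries :=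
  commute_of_coeff fun i j => by
    rw [coeff_formalDeriv, fSeries, coeff_mk, coeff_mk]
    exact (T.F_comm _ _).smul_left _

theorem C_e_mul_fSeries : C T.e * T.fSeries = T.fSeries * C T.e + T.hSeries := by
  ext i
  rw [coeff_C_mul, map_add, coeff_mul_C, fSeries, hSeries, coeff_mk, coeff_mk, T.e_F, pow_succ']

theorem hSeries_mul_fSeries :
    T.hSeries * T.fSeries = T.fSeries * T.hSeries - 2 • formalDeriv T.fSeries := by
  ext n
  have term : ∀ p ∈ antidiagonal n, coeff p.1 T.hSeries * coeff p.2 T.fSeries =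
      coeff p.2 T.fSeries * coeff p.1 T.hSeries - 2 • T.F (Polynomial.X ^ (n + 1)) :=
    fun p hp => by
      rw [hSeries, fSeries, coeff_mk, coeff_mk, T.H_F, ← pow_add, add_right_comm,
        mem_antidiagonal.1 hp, two_smul, two_smul]
  rw [coeff_mul, sum_congr rfl term, sum_sub_distrib, sum_const, Nat.card_antidiagonal, map_sub,
    map_nsmul, coeff_formalDeriv, coeff_mul, ← Nat.sum_antidiagonal_swap, smul_comm]
  simp only [Prod.fst_swap, Prod.snd_swap, fSeries, coeff_mk]

theorem C_e_mul_fSeries_pow_succ (m : ℕ) : C T.e * T.fSeries ^ (m + 1) =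
    T.fSeries ^ (m + 1) * C T.e +
      (m + 1) • (T.fSeries ^ m * T.hSeries - formalDeriv (T.fSeries ^ m)) := by
  induction m with
  | zero => rw [zero_add, pow_one, pow_zero, formalDeriv_one, sub_zero, one_mul, one_smul,
      C_e_mul_fSeries]
  | succ m ih =>
    have deriv_pow := formalDeriv_pow_succ T.commute_formalDeriv_fSeries m
    have deriv_split : formalDeriv (T.fSeries ^ m) * T.fSeries =
        formalDeriv (T.fSeries ^ (m + 1)) - T.fSeries ^ m * formalDeriv T.fSeries := by
      rw [pow_succ, formalDeriv_mul, add_sub_cancel_right]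
    calc C T.e * T.fSeries ^ (m + 1 + 1)
        = (T.fSeries ^ (m + 1) * C T.e) * T.fSeries +
            (m + 1) • (T.fSeries ^ m * T.hSeries * T.fSeries -
              formalDeriv (T.fSeries ^ m) * T.fSeries) := by
          rw [pow_succ _ (m + 1), ← mul_assoc, ih, add_mul, smul_mul_assoc, sub_mul]
      _ = T.fSeries ^ (m + 1 + 1) * C T.e + (T.fSeries ^ (m + 1) * T.hSeries +
            (m + 1) • (T.fSeries ^ (m + 1) * T.hSeries - T.fSeries ^ m * formalDeriv T.fSeries -
              formalDeriv (T.fSeries ^ (m + 1)))) := by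
          rw [mul_assoc, C_e_mul_fSeries, mul_assoc, hSeries_mul_fSeries, deriv_split]
          simp only [mul_add, mul_sub, ← mul_assoc, ← pow_succ, two_smul, smul_sub, smul_add]
          abel
      _ = _ := by
          rw [smul_sub (m + 1) (_ - _), smul_sub (m + 1) (T.fSeries ^ (m + 1) * _), ← deriv_pow]
          simp only [succ_nsmul, smul_sub]
          abel

variable {T} {δ : R[X] →ₗ[R] R} [Module R V] {Ψ : V}

theorem C_e_mem_seriesAnnihilator (hΨ : T.IsHighest δ Ψ) : C T.e ∈ seriesAnnihilator Ψ :=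
  fun n => by
    rw [coeff_C]
    split_ifs
    · exact hΨ.e_smul
    · exact zero_smul A Ψ

theorem hSeries_sub_mem_seriesAnnihilator [IsScalarTower R A V] (hΨ : T.IsHighest δ Ψ) :
    T.hSeries - PowerSeries.map (algebraMap R A)
      (PowerSeries.mk fun i => δ (Polynomial.X ^ (i + 1))) ∈ seriesAnnihilator Ψ := fun n => by
  rw [map_sub, coeff_map, hSeries, coeff_mk, coeff_mk, sub_smul, algebraMap_smul, hΨ.H_smul,
    sub_self]

end Series

section WeightSeries

variable {R : Type*} [CommRing R] [Algebra ℚ R] (δ : R[X] →ₗ[R] R)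

/-- The series `exp (-∑ δ(X ^ n) uⁿ / n)`, whose coefficients turn out to be `(-1)ᵏ` times the
eigenvalues `λ_k` of a highest weight vector of weight `δ`. -/
def weightSeries : R⟦X⟧ :=
  (exp R).subst (PowerSeries.mk fun n => -(algebraMap ℚ R (n : ℚ)⁻¹ * δ (Polynomial.X ^ n)))

theorem constantCoeff_weightExponent : constantCoeff (PowerSeries.mk fun n : ℕ =>
    -(algebraMap ℚ R (n : ℚ)⁻¹ * δ (Polynomial.X ^ n))) = 0 := by
  rw [← coeff_zero_eq_constantCoeff_apply, coeff_mk, Nat.cast_zero, inv_zero, map_zero, zero_mul,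
    neg_zero]

theorem constantCoeff_weightSeries : constantCoeff (weightSeries δ) = 1 := by
  have hg := constantCoeff_weightExponent δ
  have exp_sub_one : constantCoeff (exp R - 1) = 0 := by
    rw [map_sub, constantCoeff_exp, map_one, sub_self]
  have subst_sub_one := constantCoeff_subst_eq_zero hg _ exp_sub_one
  rw [← coe_substAlgHom (.of_constantCoeff_zero' hg), map_sub, map_one, map_sub, map_one,
    coe_substAlgHom, sub_eq_zero] at subst_sub_one
  exact subst_sub_one

theorem derivative_weightSeries : d⁄dX R (weightSeries δ) =
    -(PowerSeries.mk fun i => δ (Polynomial.X ^ (i + 1))) * weightSeries δ := by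
  rw [weightSeries, derivative_subst (.of_constantCoeff_zero' (constantCoeff_weightExponent δ)),
    derivative_exp, mul_comm]
  congr 1
  ext n
  have cancel : algebraMap ℚ R ((n + 1 : ℕ) : ℚ)⁻¹ * ((n : R) + 1) = 1 := by
    rw [← Nat.cast_succ, ← map_natCast (algebraMap ℚ R) (n + 1), ← map_mul,
      inv_mul_cancel₀ (Nat.cast_ne_zero.2 n.succ_ne_zero), map_one]
  rw [coeff_derivative, coeff_mk, map_neg, coeff_mk, neg_mul, mul_right_comm, cancel, one_mul]

end WeightSeries

section HighestWeight

variable {R A V : Type*} [CommRing R] [Algebra ℚ R] [Ring A] [Algebra R A] [AddCommGroup V]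
  [Module A V] (T : LoopTriple R A) (δ : R[X] →ₗ[R] R)

/-- The series `∑ i, cᵢ uⁱ` with coefficients in `A` such that, for a highest weight vector `Ψ` of
weight `δ`, the element `e ^ k * F 1 ^ (m + k)` acts on `Ψ` as a multiple of `c_k`. -/
def descentSeries (m : ℕ) : A⟦X⟧ :=
  T.fSeries ^ m * PowerSeries.map (algebraMap R A) (weightSeries δ)

variable {T δ} [Module R V] [IsScalarTower R A V] {Ψ : V}

theorem formalDeriv_descentSeries (m : ℕ) : formalDeriv (T.descentSeries δ m) =
    formalDeriv (T.fSeries ^ m) * PowerSeries.map (algebraMap R A) (weightSeries δ) -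
      T.descentSeries δ m * PowerSeries.map (algebraMap R A)
        (PowerSeries.mk fun i => δ (Polynomial.X ^ (i + 1))) := by
  rw [descentSeries, formalDeriv_mul, formalDeriv_map, derivative_weightSeries, neg_mul, mul_comm,
    map_neg, map_mul, mul_neg, ← sub_eq_add_neg, mul_assoc]

theorem C_e_mul_descentSeries_mem (hΨ : T.IsHighest δ Ψ) (m : ℕ) :
    C T.e * T.descentSeries δ (m + 1) + (m + 1) • formalDeriv (T.descentSeries δ m) ∈
      seriesAnnihilator Ψ := by
  have expand : C T.e * T.descentSeries δ (m + 1) + (m + 1) • formalDeriv (T.descentSeries δ m) =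
      T.descentSeries δ (m + 1) * C T.e + (m + 1) • (T.descentSeries δ m * (T.hSeries -
        PowerSeries.map (algebraMap R A)
          (PowerSeries.mk fun i => δ (Polynomial.X ^ (i + 1))))) := by
    rw [formalDeriv_descentSeries, mul_sub]
    simp only [descentSeries]
    rw [← mul_assoc, C_e_mul_fSeries_pow_succ, add_mul, smul_mul_assoc, sub_mul,
      mul_assoc (T.fSeries ^ m), mul_assoc (T.fSeries ^ (m + 1)),
      mul_assoc (T.fSeries ^ m) _ T.hSeries, mul_assoc (T.fSeries ^ (m + 1)) _ (C T.e),
      (commute_map_algebraMap _ T.hSeries).eq, (commute_map_algebraMap _ (C T.e)).eq]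
    simp only [smul_sub]
    abel
  rw [expand]
  exact add_mem (Ideal.mul_mem_left _ _ (C_e_mem_seriesAnnihilator hΨ))
    (nsmul_mem (Ideal.mul_mem_left _ _ (hSeries_sub_mem_seriesAnnihilator hΨ)) _)

theorem e_smul_coeff_descentSeries (hΨ : T.IsHighest δ Ψ) (m i : ℕ) :
    T.e • coeff i (T.descentSeries δ (m + 1)) • Ψ =
      -(((m + 1) * (i + 1)) • coeff (i + 1) (T.descentSeries δ m) • Ψ) := by
  have h := C_e_mul_descentSeries_mem hΨ m i
  rwa [map_add, coeff_C_mul, map_nsmul, coeff_formalDeriv, add_smul, mul_smul, smul_assoc,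
    smul_assoc, ← mul_smul (m + 1) (i + 1), add_eq_zero_iff_eq_neg] at h

theorem e_pow_smul_coeff_descentSeries (hΨ : T.IsHighest δ Ψ) (m k i : ℕ) :
    T.e ^ k • coeff i (T.descentSeries δ (m + k)) • Ψ =
      ((-1 : ℤ) ^ k * ((m + 1).ascFactorial k * (i + 1).ascFactorial k : ℕ)) •
        coeff (i + k) (T.descentSeries δ m) • Ψ := by
  induction k generalizing i with
  | zero => simp only [pow_zero, Nat.ascFactorial_zero, mul_one, Nat.cast_one, one_smul, add_zero]
  | succ k ih =>
    rw [pow_succ, mul_smul, ← add_assoc m, e_smul_coeff_descentSeries hΨ, smul_neg,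
      ← natCast_zsmul, smul_comm _ (_ : ℤ), ih, smul_smul, ← neg_smul, add_assoc i 1 k,
      add_comm 1 k, Nat.ascFactorial_succ, Nat.ascFactorial_succ, ← Nat.succ_ascFactorial (i + 1)]
    congr 1
    push_cast
    ring

theorem e_pow_smul_F_one_pow (hΨ : T.IsHighest δ Ψ) (m k : ℕ) :
    T.e ^ k • T.F 1 ^ (m + k) • Ψ =
      ((-1 : ℤ) ^ k * ((m + 1).ascFactorial k * k ! : ℕ)) •
        coeff k (T.descentSeries δ m) • Ψ := by
  have coeff_zero : coeff 0 (T.descentSeries δ (m + k)) = T.F 1 ^ (m + k) := by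
    rw [descentSeries, coeff_zero_eq_constantCoeff_apply, map_mul, map_pow,
      ← coeff_zero_eq_constantCoeff_apply, fSeries, coeff_mk, pow_zero Polynomial.X,
      ← coeff_zero_eq_constantCoeff_apply, coeff_map, coeff_zero_eq_constantCoeff_apply,
      constantCoeff_weightSeries, map_one (algebraMap R A), mul_one]
  rw [← coeff_zero, e_pow_smul_coeff_descentSeries hΨ, zero_add, zero_add, Nat.one_ascFactorial]

theorem coeff_descentSeries_smul_eq_zero (hΨ : T.IsHighest δ Ψ) {m k : ℕ}
    (h : T.F 1 ^ (m + k) • Ψ = 0) : coeff k (T.descentSeries δ m) • Ψ = 0 := by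
  let _ : Module ℚ V := .compHom V (algebraMap ℚ R)
  have : IsAddTorsionFree V := .of_module_rat V
  have key := e_pow_smul_F_one_pow hΨ m k
  rw [h, smul_zero] at key
  refine (smul_eq_zero.1 key.symm).resolve_left ?_
  exact mul_ne_zero (pow_ne_zero _ (by norm_num)) (Nat.cast_ne_zero.2
    (mul_ne_zero (Nat.ascFactorial_pos m k).ne' k.factorial_ne_zero))

end HighestWeight

end LoopTriple

section GeometricSeries

variable {R : Type*} [CommRing R]

/-- The geometric series `∑ bⁿ uⁿ = 1 / (1 - b u)`. -/
def geomSeries (b : R) : R⟦X⟧ := PowerSeries.mk (b ^ ·)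

theorem geomSeries_mul_one_sub (b : R) : geomSeries b * (1 - C b * X) = 1 := by
  ext n
  rw [mul_sub, mul_one, mul_left_comm, map_sub, coeff_C_mul, geomSeries, coeff_mk, coeff_one]
  cases n with
  | zero => rw [coeff_zero_mul_X, mul_zero, sub_zero, pow_zero, if_pos rfl]
  | succ n => rw [coeff_succ_mul_X, coeff_mk, pow_succ', sub_self, if_neg n.succ_ne_zero]

variable {ι : Type*}

theorem coeff_geomSeries_mul_prod (b : R) (c : ι → R) (S : Finset ι) (m : ℕ) :
    coeff (#S + m) (geomSeries b * ∏ i ∈ S, (1 - C (c i) * X)) = b ^ m * ∏ i ∈ S, (b - c i) := by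
  classical
  induction S using Finset.induction_on generalizing m with
  | empty => rw [card_empty, zero_add, prod_empty, prod_empty, mul_one, mul_one, geomSeries,
      coeff_mk]
  | insert j S hj ih =>
    rw [card_insert_of_notMem hj, prod_insert hj, prod_insert hj, mul_left_comm, sub_mul, one_mul,
      mul_assoc, map_sub, coeff_C_mul, add_right_comm, coeff_succ_X_mul, ih, add_assoc, ih]
    ring

theorem coeff_geomSeries_mul_geomSeries_mul_prod [DecidableEq ι] (b : R) (c : ι → R)
    {S : Finset ι} {j : ι} (hj : j ∈ S) :
    coeff (#S - 1) (geomSeries b * geomSeries (c j) * ∏ i ∈ S, (1 - C (c i) * X)) =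
      ∏ i ∈ S.erase j, (b - c i) := by
  rw [← mul_prod_erase S _ hj, mul_assoc, ← mul_assoc (geomSeries (c j)), geomSeries_mul_one_sub,
    one_mul, ← card_erase_of_mem hj]
  simpa only [add_zero, pow_zero, one_mul] using coeff_geomSeries_mul_prod b c (S.erase j) 0

theorem coeff_mul_eq_of_X_pow_dvd_sub {f g : R⟦X⟧} {n : ℕ} (h : X ^ (n + 1) ∣ f - g) (p : R⟦X⟧)
    {k : ℕ} (hk : k ≤ n) : coeff k (p * f) = coeff k (p * g) := by
  rw [← sub_eq_zero, ← map_sub, ← mul_sub]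
  exact X_pow_dvd_iff.1 (h.mul_left p) k (Nat.lt_succ_of_le hk)

end GeometricSeries

section Nodal

variable {K ι : Type*} [Field K] [Fintype ι] {a : ι → K}

theorem nodal_univ_dvd_of_eval_eq_zero (ha : Function.Injective a) {f : K[X]}
    (hf : ∀ i, f.eval (a i) = 0) : nodal univ a ∣ f :=
  Finset.prod_dvd_of_coprime
    (fun _ _ _ _ hij => Polynomial.pairwise_coprime_X_sub_C ha hij)
    fun i _ => Polynomial.dvd_iff_isRoot.2 (hf i)

theorem nodalWeight_mul_eval_nodal_erase [DecidableEq ι] (ha : Function.Injective a) (i j : ι) :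
    nodalWeight univ a j * (nodal (univ.erase j) a).eval (a i) = if i = j then 1 else 0 := by
  split_ifs with h
  · subst h
    have := nodalWeight_ne_zero (s := univ) ha.injOn (mem_univ i)
    rw [nodalWeight_eq_eval_nodal_erase_inv] at this ⊢
    exact inv_mul_cancel₀ (inv_eq_zero.not.1 this)
  · rw [eval_nodal_at_node (mem_erase.2 ⟨h, mem_univ i⟩), mul_zero]

end Nodal

namespace LoopTriple

section Evaluation

variable {R A V ι : Type*} [CommRing R] [Ring A] [Algebra R A] [AddCommGroup V] [Module A V]
  {T : LoopTriple R A} {a : ι → R}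

/-- The action of `F f` on `Ψ` only depends on the values of `f` at the parameters `a i`. -/
def IsEvaluatedAt (T : LoopTriple R A) (a : ι → R) (Ψ : V) : Prop :=
  ∀ f : R[X], (∀ i, f.eval (a i) = 0) → T.F f • Ψ = 0

theorem IsEvaluatedAt.smul {Ψ : V} (hΨ : T.IsEvaluatedAt a Ψ) {x : A}
    (hx : ∀ f, Commute (T.F f) x) : T.IsEvaluatedAt a (x • Ψ) := fun f hf => by
  rw [← mul_smul, (hx f).eq, mul_smul, hΨ f hf, smul_zero]

theorem coeff_fSeries_mul_map (n : ℕ) (Λ : R⟦X⟧) :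
    coeff n (T.fSeries * PowerSeries.map (algebraMap R A) Λ) =
      T.F (coeff n (geomSeries Polynomial.X * PowerSeries.map Polynomial.C Λ)) := by
  rw [coeff_mul, coeff_mul, map_sum]
  refine sum_congr rfl fun p _ => ?_
  rw [coeff_map, coeff_map, geomSeries, fSeries, coeff_mk, coeff_mk, mul_comm (_ ^ _),
    ← Polynomial.smul_eq_C_mul, map_smul, ← Algebra.commutes, Algebra.smul_def]

variable [Fintype ι] [DecidableEq ι]

/-- The lowering element `ρ_j` attached to the polynomial `∏_{i ≠ j} (t - a i)`. -/
def rho (T : LoopTriple R A) (a : ι → R) (j : ι) : A := T.F (nodal (univ.erase j) a)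

theorem commute_F_rho (f : R[X]) (j : ι) : Commute (T.F f) (T.rho a j) := T.F_comm _ _

variable [Module R V] [IsScalarTower R A V] {Ψ : V}

theorem F_mul_nodal_smul (hΨ : T.IsEvaluatedAt a Ψ) (g : R[X]) (j : ι) :
    T.F (g * nodal (univ.erase j) a) • Ψ = g.eval (a j) • T.rho a j • Ψ := by
  have vanish : T.F ((g - Polynomial.C (g.eval (a j))) * nodal (univ.erase j) a) • Ψ = 0 :=
    hΨ _ fun i => by
      rw [Polynomial.eval_mul]
      obtain rfl | hij := eq_or_ne i j
      · rw [Polynomial.eval_sub, Polynomial.eval_C, sub_self, zero_mul]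
      · rw [eval_nodal_at_node (mem_erase.2 ⟨hij, mem_univ i⟩), mul_zero]
  rwa [sub_mul, ← Polynomial.smul_eq_C_mul, map_sub, map_smul, sub_smul, smul_assoc,
    sub_eq_zero] at vanish

theorem H_smul_rho_smul {g : R[X]} {c : R} (hv : T.H g • Ψ = c • Ψ) (hΨ : T.IsEvaluatedAt a Ψ)
    (j : ι) : T.H g • T.rho a j • Ψ = (c - 2 * g.eval (a j)) • T.rho a j • Ψ := by
  rw [← mul_smul, rho, T.H_F, sub_smul, mul_smul, hv, smul_assoc, F_mul_nodal_smul hΨ,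
    smul_algebra_smul_comm, sub_smul, mul_smul, rho]

end Evaluation

section Interpolation

variable {K A V ι : Type*} [Field K] [Ring A] [Algebra K A] [AddCommGroup V] [Module A V]
  [Module K V] [IsScalarTower K A V] [Fintype ι] [DecidableEq ι] {T : LoopTriple K A} {a : ι → K}
  {Ψ : V}

theorem F_smul_eq_sum_rho (ha : Function.Injective a) (hΨ : T.IsEvaluatedAt a Ψ) (f : K[X]) :
    T.F f • Ψ = ∑ j, (nodalWeight univ a j * f.eval (a j)) • T.rho a j • Ψ := by
  have vanish := hΨ (f - ∑ j, (nodalWeight univ a j * f.eval (a j)) • nodal (univ.erase j) a)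
    fun i => by
      simp only [Polynomial.eval_sub, Polynomial.eval_finsetSum, Polynomial.eval_smul,
        smul_eq_mul, mul_right_comm, nodalWeight_mul_eval_nodal_erase ha, ite_mul, one_mul,
        zero_mul, sum_ite_eq, mem_univ, if_true, sub_self]
  simpa only [map_sub, map_sum, map_smul, sub_smul, sum_smul, smul_assoc, sub_eq_zero, rho]
    using vanish

variable (T a) in
/-- The generating series of the lowering elements after Lagrange interpolation at the parameters;
on a vector evaluated at the parameters it acts as `fSeries`. -/
def interpSeries : A⟦X⟧ := ∑ j, C (T.rho a j) *
  PowerSeries.map (algebraMap K A) (C (nodalWeight univ a j) * geomSeries (a j))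

theorem coeff_interpSeries (n : ℕ) : coeff n (T.interpSeries a) =
    ∑ j, (nodalWeight univ a j * a j ^ n) • T.rho a j := by
  rw [interpSeries, map_sum]
  refine sum_congr rfl fun j _ => ?_
  rw [coeff_C_mul, coeff_map, coeff_C_mul, geomSeries, coeff_mk, ← Algebra.commutes,
    Algebra.smul_def]

theorem commute_fSeries_interpSeries : Commute T.fSeries (T.interpSeries a) :=
  commute_of_coeff fun i k => by
    rw [coeff_interpSeries, fSeries, coeff_mk]
    exact Commute.sum_right _ _ _ fun j _ => (T.commute_F_rho _ j).smul_right _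

theorem interpSeries_mul_interpSeries : T.interpSeries a * T.interpSeries a =
    ∑ i, ∑ j, C (T.rho a i * T.rho a j) *
      PowerSeries.map (algebraMap K A) (C (nodalWeight univ a i * nodalWeight univ a j) *
        (geomSeries (a i) * geomSeries (a j))) := by
  rw [interpSeries, sum_mul_sum]
  refine sum_congr rfl fun i _ => sum_congr rfl fun j _ => ?_
  rw [mul_assoc, ← mul_assoc (PowerSeries.map _ _), (commute_map_algebraMap _ (C _)).eq, mul_assoc,
    ← mul_assoc, ← map_mul, ← map_mul, map_mul C (nodalWeight _ _ _), mul_mul_mul_comm]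

theorem fSeries_sub_interpSeries_mem (ha : Function.Injective a) (hΨ : T.IsEvaluatedAt a Ψ) :
    T.fSeries - T.interpSeries a ∈ seriesAnnihilator Ψ := fun n => by
  rw [map_sub, coeff_interpSeries, fSeries, coeff_mk, sub_smul, F_smul_eq_sum_rho ha hΨ, sum_smul,
    sub_eq_zero]
  simp only [Polynomial.eval_pow, Polynomial.eval_X, smul_assoc]

theorem fSeries_sq_sub_interpSeries_sq_mem (ha : Function.Injective a) (hΨ : T.IsEvaluatedAt a Ψ)
    (Λ : K⟦X⟧) : (T.fSeries ^ 2 - T.interpSeries a * T.interpSeries a) *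
      PowerSeries.map (algebraMap K A) Λ ∈ seriesAnnihilator Ψ := by
  rw [← (commute_map_algebraMap Λ _).eq, sq, commute_fSeries_interpSeries.mul_self_sub_mul_self_eq]
  exact Ideal.mul_mem_left _ _ (Ideal.mul_mem_left _ _ (fSeries_sub_interpSeries_mem ha hΨ))

theorem coeff_interpSeries_sq_mul (ha : Function.Injective a) {Λ : K⟦X⟧}
    (hΛ : X ^ (Fintype.card ι + 1) ∣ Λ - ∏ i, (1 - C (a i) * X)) :
    coeff (Fintype.card ι - 1) (T.interpSeries a * T.interpSeries a *
      PowerSeries.map (algebraMap K A) Λ) =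
        ∑ j, nodalWeight univ a j • (T.rho a j * T.rho a j) := by
  have coeff_geom : ∀ i j, coeff (Fintype.card ι - 1) (geomSeries (a i) * geomSeries (a j) * Λ) =
      (nodal (univ.erase j) a).eval (a i) := fun i j => by
    rw [coeff_mul_eq_of_X_pow_dvd_sub hΛ _ (Nat.sub_le _ _), ← card_univ,
      coeff_geomSeries_mul_geomSeries_mul_prod _ _ (mem_univ j), eval_nodal]
  simp only [interpSeries_mul_interpSeries, sum_mul, mul_assoc (C (_ : A)), ← map_mul, map_sum,
    coeff_C_mul, coeff_map, mul_assoc (C (_ : K)), coeff_geom]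
  refine sum_congr rfl fun i _ => ?_
  simp only [mul_assoc (nodalWeight univ a i), nodalWeight_mul_eval_nodal_erase ha, mul_ite,
    mul_one, mul_zero, apply_ite (algebraMap K A), map_zero, sum_ite_eq, mem_univ, if_true]
  rw [← Algebra.commutes, Algebra.smul_def]

end Interpolation

section Vanishing

variable {K A V ι : Type*} [Field K] [CharZero K] [Ring A] [Algebra K A] [AddCommGroup V]
  [Module A V] [Module K V] [IsScalarTower K A V] [Fintype ι] {T : LoopTriple K A} {a : ι → K}
  {δ : K[X] →ₗ[K] K} {Ψ : V}

theorem F_mul_smul_eq_zero (hΨ : T.IsHighest δ Ψ) {f : K[X]} (hf : T.F f • Ψ = 0) (g : K[X]) :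
    T.F (g * f) • Ψ = 0 := by
  have h : T.H g • T.F f • Ψ = 0 := by rw [hf, smul_zero]
  rw [← mul_smul, T.H_F, sub_smul, mul_smul, hΨ.H_smul, smul_algebra_smul_comm, hf, smul_zero,
    zero_sub, neg_eq_zero, smul_assoc] at h
  exact (smul_eq_zero.1 h).resolve_left two_ne_zero

theorem F_nodal_smul_eq_zero (hΨ : T.IsHighest δ Ψ)
    (hnil : T.F 1 ^ (Fintype.card ι + 1) • Ψ = 0)
    (hδ : X ^ (Fintype.card ι + 1) ∣ weightSeries δ - ∏ i, (1 - C (a i) * X)) :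
    T.F (nodal univ a) • Ψ = 0 := by
  have coeff_eq := coeff_descentSeries_smul_eq_zero hΨ (m := 1) (by rwa [add_comm 1])
  have map_hδ := map_dvd (PowerSeries.map Polynomial.C) hδ
  simp only [map_pow, map_X, map_sub, map_prod, map_one, map_mul, map_C] at map_hδ
  have coeff_geom := coeff_geomSeries_mul_prod Polynomial.X (fun i => Polynomial.C (a i)) univ 0
  rw [add_zero, pow_zero, one_mul, card_univ] at coeff_geom
  rwa [descentSeries, pow_one, coeff_fSeries_mul_map, coeff_mul_eq_of_X_pow_dvd_sub map_hδ _ le_rfl,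
    coeff_geom] at coeff_eq

theorem isEvaluatedAt_of_F_one_pow_smul_eq_zero (hΨ : T.IsHighest δ Ψ) (ha : Function.Injective a)
    (hnil : T.F 1 ^ (Fintype.card ι + 1) • Ψ = 0)
    (hδ : X ^ (Fintype.card ι + 1) ∣ weightSeries δ - ∏ i, (1 - C (a i) * X)) :
    T.IsEvaluatedAt a Ψ := fun f hf => by
  obtain ⟨g, rfl⟩ := nodal_univ_dvd_of_eval_eq_zero ha hf
  rw [mul_comm]
  exact F_mul_smul_eq_zero hΨ (F_nodal_smul_eq_zero hΨ hnil hδ) g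

variable [DecidableEq ι]

theorem sum_nodalWeight_smul_rho_sq_smul (hΨ : T.IsHighest δ Ψ) (ha : Function.Injective a)
    (hnil : T.F 1 ^ (Fintype.card ι + 1) • Ψ = 0)
    (hδ : X ^ (Fintype.card ι + 1) ∣ weightSeries δ - ∏ i, (1 - C (a i) * X)) :
    ∑ j, nodalWeight univ a j • T.rho a j • T.rho a j • Ψ = 0 := by
  cases isEmpty_or_nonempty ι
  · exact Fintype.sum_empty _
  have hev := isEvaluatedAt_of_F_one_pow_smul_eq_zero hΨ ha hnil hδ
  have exponent : 2 + (Fintype.card ι - 1) = Fintype.card ι + 1 := by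
    have := Fintype.card_pos (α := ι)
    omega
  have coeff_eq := coeff_descentSeries_smul_eq_zero hΨ (m := 2) (exponent ▸ hnil)
  have interp := fSeries_sq_sub_interpSeries_sq_mem ha hev (weightSeries δ) (Fintype.card ι - 1)
  rw [sub_mul, map_sub, sub_smul, coeff_interpSeries_sq_mul ha hδ] at interp
  rw [descentSeries] at coeff_eq
  rw [coeff_eq, zero_sub, neg_eq_zero, sum_smul] at interp
  simpa only [smul_assoc, mul_smul] using interp

theorem rho_smul_rho_smul_eq_zero (hΨ : T.IsHighest δ Ψ) (ha : Function.Injective a)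
    (hnil : T.F 1 ^ (Fintype.card ι + 1) • Ψ = 0)
    (hδ : X ^ (Fintype.card ι + 1) ∣ weightSeries δ - ∏ i, (1 - C (a i) * X)) (j : ι) :
    T.rho a j • T.rho a j • Ψ = 0 := by
  have hev := isEvaluatedAt_of_F_one_pow_smul_eq_zero hΨ ha hnil hδ
  have sum_eq := sum_nodalWeight_smul_rho_sq_smul hΨ ha hnil hδ
  have weight : ∀ g i, T.H g • T.rho a i • T.rho a i • Ψ =
      (δ g - 4 * g.eval (a i)) • T.rho a i • T.rho a i • Ψ := fun g i => by
    rw [H_smul_rho_smul (H_smul_rho_smul (hΨ.H_smul g) hev i)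
      (hev.smul fun f => commute_F_rho f i) i]
    ring_nf
  have separate : ∀ g : K[X],
      ∑ i, (nodalWeight univ a i * g.eval (a i)) • T.rho a i • T.rho a i • Ψ = 0 := fun g => by
    have h := congrArg (fun v => δ g • v - T.H g • v) sum_eq
    simp only [smul_sum, smul_zero, sub_self, smul_algebra_smul_comm _ (T.H g), weight,
      ← sum_sub_distrib] at h
    refine (smul_eq_zero.1 ((smul_sum.trans (sum_congr rfl fun i _ => ?_)).trans h)).resolve_left
      (show (4 : K) ≠ 0 by norm_num)
    generalize T.rho a i • T.rho a i • Ψ = x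
    module
  have single := separate (nodal (univ.erase j) a)
  rwa [sum_eq_single_of_mem j (mem_univ j) fun i _ hij => by
      rw [eval_nodal_at_node (mem_erase.2 ⟨hij, mem_univ i⟩), mul_zero, zero_smul],
    nodalWeight_mul_eval_nodal_erase ha, if_pos rfl, one_smul] at single

end Vanishing

end LoopTriple

section Span

variable {K A V : Type*} [CommRing K] [Ring A] [Algebra K A] [AddCommGroup V] [Module A V]
  [Module K V] [IsScalarTower K A V]

theorem smul_mem_of_mem_span {x : A} {s : Set V} {W : Submodule K V} (h : ∀ v ∈ s, x • v ∈ W)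
    {v : V} (hv : v ∈ Submodule.span K s) : x • v ∈ W :=
  (Submodule.span_le (p := W.comap (Algebra.lsmul K K V x))).2 h hv

theorem smul_mem_of_adjoin_eq_top {s : Set A} (hs : Algebra.adjoin K s = ⊤) {W : Submodule K V}
    (h : ∀ x ∈ s, ∀ v ∈ W, x • v ∈ W) (x : A) : ∀ v ∈ W, x • v ∈ W := by
  have hx : x ∈ Algebra.adjoin K s := hs ▸ Algebra.mem_top
  induction hx using Algebra.adjoin_induction with
  | mem x hx => exact h x hx
  | algebraMap c => exact fun v hv => (algebraMap_smul A c v).symm ▸ W.smul_mem c hv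
  | add x y _ _ hx hy => exact fun v hv => add_smul x y v ▸ W.add_mem (hx v hv) (hy v hv)
  | mul x y _ _ hx hy => exact fun v hv => mul_smul x y v ▸ hx _ (hy v hv)

theorem mem_span_image_of_smul_eq_smul [IsDomain K] {I : Type*} {v : I → V}
    (hli : LinearIndependent K v) {x : A} {c : I → K} (hc : ∀ i, x • v i = c i • v i) {w : V}
    (hw : w ∈ Submodule.span K (Set.range v)) {μ : K} (hμ : x • w = μ • w) :
    w ∈ Submodule.span K (v '' {i | c i = μ}) := by
  obtain ⟨b, rfl⟩ := Finsupp.mem_span_range_iff_exists_finsupp.1 hw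
  refine Submodule.sum_mem _ fun i hi => Submodule.smul_mem _ _ (Submodule.subset_span ⟨i, ?_, rfl⟩)
  have relation : ∑ i ∈ b.support, (b i * (c i - μ)) • v i = 0 := by
    rw [Finsupp.sum, smul_sum, smul_sum, ← sub_eq_zero, ← sum_sub_distrib] at hμ
    rw [← hμ]
    refine sum_congr rfl fun i _ => ?_
    rw [smul_algebra_smul_comm, hc, mul_sub, sub_smul, mul_smul, mul_comm, mul_smul]
  exact sub_eq_zero.1 ((mul_eq_zero.1 (linearIndependent_iff'.1 hli _ _ relation i hi)).resolve_left
    (Finsupp.mem_support_iff.1 hi))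

end Span

namespace LoopTriple

section Products

variable {R A V ι : Type*} [CommRing R] [Ring A] [Algebra R A] [AddCommGroup V] [Module A V]
  [Fintype ι] [DecidableEq ι] {T : LoopTriple R A} {a : ι → R} {Ψ : V}

/-- The product of the lowering elements `ρ_j` over `j ∈ S`; the factors commute. -/
def rhoProd (T : LoopTriple R A) (a : ι → R) (S : Finset ι) : A :=
  S.noncommProd (T.rho a) fun _ _ _ _ _ => T.F_comm _ _

theorem rhoProd_empty : T.rhoProd a ∅ = 1 := noncommProd_empty _ _

theorem rhoProd_insert {j : ι} {S : Finset ι} (hj : j ∉ S) :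
    T.rhoProd a (insert j S) = T.rho a j * T.rhoProd a S :=
  noncommProd_insert_of_notMem _ _ _ _ hj

theorem rhoProd_union {S S' : Finset ι} (h : Disjoint S S') :
    T.rhoProd a (S ∪ S') = T.rhoProd a S * T.rhoProd a S' :=
  noncommProd_union_of_disjoint h _ _

theorem commute_F_rhoProd (f : R[X]) (S : Finset ι) : Commute (T.F f) (T.rhoProd a S) :=
  noncommProd_commute _ _ _ _ fun _ _ => T.F_comm _ _

theorem rho_smul_rhoProd_smul_eq_zero (hsq : ∀ j, T.rho a j • T.rho a j • Ψ = 0) {j : ι}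
    {S : Finset ι} (hj : j ∈ S) : T.rho a j • T.rhoProd a S • Ψ = 0 := by
  rw [← insert_erase hj, rhoProd_insert (notMem_erase j S), rho, ← mul_smul,
    ((T.F_comm _ _).mul_right (commute_F_rhoProd _ _)).eq,
    (commute_F_rhoProd _ _).eq, mul_assoc, mul_smul, mul_smul]
  exact (congrArg _ (hsq j)).trans (smul_zero _)

theorem rhoProd_smul_rhoProd_smul_eq_zero (hsq : ∀ j, T.rho a j • T.rho a j • Ψ = 0)
    {S S' : Finset ι} (h : ¬ Disjoint S S') : T.rhoProd a S • T.rhoProd a S' • Ψ = 0 := by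
  obtain ⟨j, hj, hj'⟩ := not_disjoint_iff.1 h
  rw [← insert_erase hj, rhoProd_insert (notMem_erase j S), rho, (commute_F_rhoProd _ _).eq,
    mul_smul]
  exact (congrArg _ (rho_smul_rhoProd_smul_eq_zero hsq hj')).trans (smul_zero _)

theorem IsEvaluatedAt.rhoProd_smul (hΨ : T.IsEvaluatedAt a Ψ) (S : Finset ι) :
    T.IsEvaluatedAt a (T.rhoProd a S • Ψ) :=
  hΨ.smul fun f => commute_F_rhoProd f S

theorem H_smul_rhoProd_smul [Module R V] [IsScalarTower R A V] {g : R[X]} {c : R}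
    (hv : T.H g • Ψ = c • Ψ) (hΨ : T.IsEvaluatedAt a Ψ) (S : Finset ι) :
    T.H g • T.rhoProd a S • Ψ = (c - 2 * ∑ j ∈ S, g.eval (a j)) • T.rhoProd a S • Ψ := by
  induction S using Finset.induction_on with
  | empty => rw [rhoProd_empty, one_smul, hv, sum_empty, mul_zero, sub_zero]
  | insert j S hj ih =>
    rw [rhoProd_insert hj, mul_smul, H_smul_rho_smul ih (hΨ.rhoProd_smul S), sum_insert hj,
      mul_add, sub_sub, add_comm (2 * _)]

end Products

section ProductBasis

variable {K A V ι : Type*} [Field K] [Ring A] [Algebra K A] [AddCommGroup V] [Module A V]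
  [Module K V] [IsScalarTower K A V] [Fintype ι] [DecidableEq ι] {T : LoopTriple K A} {a : ι → K}
  {δ : K[X] →ₗ[K] K} {Ψ : V}

theorem F_smul_rhoProd_smul_mem (ha : Function.Injective a) (hΨ : T.IsEvaluatedAt a Ψ)
    (hsq : ∀ j, T.rho a j • T.rho a j • Ψ = 0) (f : K[X]) (S : Finset ι) :
    T.F f • T.rhoProd a S • Ψ ∈
      Submodule.span K ((T.rhoProd a · • Ψ) '' Set.powersetCard ι (#S + 1)) := by
  rw [F_smul_eq_sum_rho ha (hΨ.rhoProd_smul S)]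
  refine Submodule.sum_mem _ fun j _ => Submodule.smul_mem _ _ ?_
  by_cases hj : j ∈ S
  · rw [rho_smul_rhoProd_smul_eq_zero hsq hj]
    exact zero_mem _
  · rw [← mul_smul, ← rhoProd_insert hj]
    exact Submodule.subset_span ⟨_, card_insert_of_notMem hj, rfl⟩

theorem F_one_pow_smul_mem (ha : Function.Injective a) (hΨ : T.IsEvaluatedAt a Ψ)
    (hsq : ∀ j, T.rho a j • T.rho a j • Ψ = 0) (k : ℕ) :
    T.F 1 ^ k • Ψ ∈ Submodule.span K ((T.rhoProd a · • Ψ) '' Set.powersetCard ι k) := by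
  induction k with
  | zero =>
    rw [pow_zero, ← rhoProd_empty (T := T) (a := a)]
    exact Submodule.subset_span ⟨∅, card_empty, rfl⟩
  | succ k ih =>
    rw [pow_succ', mul_smul]
    refine smul_mem_of_mem_span ?_ ih
    rintro _ ⟨S, rfl, rfl⟩
    exact F_smul_rhoProd_smul_mem ha hΨ hsq 1 S

theorem rhoProd_univ_smul_ne_zero (ha : Function.Injective a) (hΨ : T.IsEvaluatedAt a Ψ)
    (hsq : ∀ j, T.rho a j • T.rho a j • Ψ = 0) (hne : T.F 1 ^ Fintype.card ι • Ψ ≠ 0) :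
    T.rhoProd a univ • Ψ ≠ 0 := fun h => by
  refine hne ((Submodule.mem_bot K).1
    (Submodule.span_le.2 ?_ (F_one_pow_smul_mem ha hΨ hsq _)))
  rintro _ ⟨S, hS, rfl⟩
  rw [(card_eq_iff_eq_univ S).1 hS]
  exact h

theorem linearIndependent_rhoProd_smul (ha : Function.Injective a) (hΨ : T.IsEvaluatedAt a Ψ)
    (hsq : ∀ j, T.rho a j • T.rho a j • Ψ = 0) (hne : T.F 1 ^ Fintype.card ι • Ψ ≠ 0) :
    LinearIndependent K (T.rhoProd a · • Ψ) := by
  rw [Fintype.linearIndependent_iff]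
  intro c hc S
  induction S using Finset.strongInduction with
  | H S ih =>
    have h := congrArg (T.rhoProd a Sᶜ • ·) hc
    simp only [smul_sum, smul_zero, smul_algebra_smul_comm] at h
    rw [Fintype.sum_eq_single S fun S' hS' => ?_] at h
    · rw [← mul_smul, ← rhoProd_union disjoint_compl_left, union_comm, union_compl] at h
      exact (smul_eq_zero.1 h).resolve_right (rhoProd_univ_smul_ne_zero ha hΨ hsq hne)
    · by_cases hsub : S' ⊆ S
      · rw [ih S' (hsub.ssubset_of_ne hS'), zero_smul]
      · rw [rhoProd_smul_rhoProd_smul_eq_zero hsq (disjoint_compl_left_iff.not.2 hsub), smul_zero]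

theorem H_smul_mem_span_rhoProd {g : K[X]} {c : K} (hc : T.H g • Ψ = c • Ψ)
    (hΨ : T.IsEvaluatedAt a Ψ) :
    ∀ v ∈ Submodule.span K (Set.range (T.rhoProd a · • Ψ)),
      T.H g • v ∈ Submodule.span K (Set.range (T.rhoProd a · • Ψ)) := fun _ =>
  smul_mem_of_mem_span <| Set.forall_mem_range.2 fun S => by
    rw [H_smul_rhoProd_smul hc hΨ]
    exact Submodule.smul_mem _ _ (Submodule.subset_span ⟨S, rfl⟩)

theorem F_smul_mem_span_rhoProd (ha : Function.Injective a) (hΨ : T.IsEvaluatedAt a Ψ)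
    (hsq : ∀ j, T.rho a j • T.rho a j • Ψ = 0) (f : K[X]) :
    ∀ v ∈ Submodule.span K (Set.range (T.rhoProd a · • Ψ)),
      T.F f • v ∈ Submodule.span K (Set.range (T.rhoProd a · • Ψ)) := fun _ =>
  smul_mem_of_mem_span <| Set.forall_mem_range.2 fun S =>
    Submodule.span_mono (Set.image_subset_range _ _) (F_smul_rhoProd_smul_mem ha hΨ hsq f S)

theorem e_smul_mem_span_rhoProd (hδ : T.IsHighest δ Ψ) (ha : Function.Injective a)
    (hΨ : T.IsEvaluatedAt a Ψ) (hsq : ∀ j, T.rho a j • T.rho a j • Ψ = 0) :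
    ∀ v ∈ Submodule.span K (Set.range (T.rhoProd a · • Ψ)),
      T.e • v ∈ Submodule.span K (Set.range (T.rhoProd a · • Ψ)) := fun _ =>
  smul_mem_of_mem_span <| Set.forall_mem_range.2 fun S => by
    induction S using Finset.induction_on with
    | empty =>
      rw [rhoProd_empty, one_smul, hδ.e_smul]
      exact zero_mem _
    | insert j S hj ih =>
      rw [rhoProd_insert hj, mul_smul, rho, ← mul_smul T.e, T.e_F, add_smul, mul_smul]
      exact add_mem (F_smul_mem_span_rhoProd ha hΨ hsq _ _ ih)
        (H_smul_mem_span_rhoProd (hδ.H_smul _) hΨ _ (Submodule.subset_span ⟨S, rfl⟩))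

theorem mem_span_rhoProd_powersetCard [CharZero K] (ha : Function.Injective a)
    (hΨ : T.IsEvaluatedAt a Ψ) (hsq : ∀ j, T.rho a j • T.rho a j • Ψ = 0)
    (hne : T.F 1 ^ Fintype.card ι • Ψ ≠ 0) {c : K} (hc : T.H 1 • Ψ = c • Ψ) {v : V} {n : ℕ}
    (hv : v ∈ Submodule.span K (Set.range (T.rhoProd a · • Ψ)))
    (hn : T.H 1 • v = (c - 2 * n) • v) :
    v ∈ Submodule.span K ((T.rhoProd a · • Ψ) '' Set.powersetCard ι n) := by
  refine Submodule.span_mono (Set.image_mono fun S hS => ?_) (mem_span_image_of_smul_eq_smul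
    (linearIndependent_rhoProd_smul ha hΨ hsq hne) (H_smul_rhoProd_smul hc hΨ) hv hn)
  simpa only [Set.mem_ofPred_eq, Polynomial.eval_one, sum_const, nsmul_one, sub_right_inj,
    mul_right_inj' (two_ne_zero' K), Nat.cast_inj, Set.powersetCard.mem_iff] using hS

end ProductBasis

end LoopTriple

section LoopPoly

attribute [local instance] LieRing.ofAssociativeRing

/-- The image in `U(L(sl₂))` of `f(t) ⊗ y`, as a linear function of the polynomial `f`. -/
def loopPoly (y : Sl2) : ℂ[X] →ₗ[ℂ] ULoop :=
  (UniversalEnvelopingAlgebra.ι ℂ (L := LoopSl2)).toLinearMap ∘ₗ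
    (TensorProduct.mk ℂ (AddMonoidAlgebra ℂ ℤ) Sl2).flip y ∘ₗ Polynomial.toLaurentAlg.toLinearMap

theorem loopPoly_apply (y : Sl2) (f : ℂ[X]) : loopPoly y f =
    UniversalEnvelopingAlgebra.ι ℂ (Polynomial.toLaurentAlg f ⊗ₜ[ℂ] y : LoopSl2) := rfl

theorem loopPoly_X_pow (y : Sl2) (n : ℕ) : loopPoly y (Polynomial.X ^ n) = loopGen y n := by
  rw [loopPoly_apply, Polynomial.toLaurentAlg_apply, Polynomial.toLaurent_X_pow,
    LaurentPolynomial.T, loopGen]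

theorem loopPoly_one (y : Sl2) : loopPoly y 1 = loopGen y 0 := loopPoly_X_pow y 0

theorem loopPoly_mul_sub_mul (y z : Sl2) (f g : ℂ[X]) :
    loopPoly y f * loopPoly z g - loopPoly z g * loopPoly y f = loopPoly ⁅y, z⁆ (f * g) := by
  simp only [← LieRing.of_associative_ring_bracket, loopPoly_apply, ← LieHom.map_lie,
    LieAlgebra.ExtendScalars.bracket_tmul, map_mul]

theorem loopPoly_smul_left (c : ℂ) (y : Sl2) (f : ℂ[X]) :
    loopPoly (c • y) f = c • loopPoly y f := by
  rw [loopPoly_apply, TensorProduct.tmul_smul, map_smul, loopPoly_apply]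

theorem loopPoly_mem {y : Sl2} {W : Submodule ℂ ULoop} {f : ℂ[X]}
    (h : ∀ n ∈ f.support, loopGen y n ∈ W) : loopPoly y f ∈ W := by
  rw [f.as_sum_support_C_mul_X_pow, map_sum]
  refine W.sum_mem fun n hn => ?_
  rw [← Polynomial.smul_eq_C_mul, map_smul, loopPoly_X_pow]
  exact W.smul_mem _ (h n hn)

end LoopPoly

section BorelTriple

theorem loopPoly_matH_mem (f : ℂ[X]) : loopPoly matH f ∈ Subalgebra.toSubmodule UB :=
  loopPoly_mem fun n _ => hGen_mem n

theorem loopPoly_matF_X_mul_mem (f : ℂ[X]) :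
    loopPoly matF (Polynomial.X * f) ∈ Subalgebra.toSubmodule UB :=
  loopPoly_mem fun n hn => xMinus_mem n <| Nat.one_le_iff_ne_zero.2 fun h =>
    Polynomial.mem_support_iff.1 hn (h ▸ Polynomial.coeff_X_mul_zero f)

theorem loopPoly_matF_comm (f g : ℂ[X]) :
    loopPoly matF f * loopPoly matF g = loopPoly matF g * loopPoly matF f := by
  rw [← sub_eq_zero, loopPoly_mul_sub_mul, lie_self, loopPoly_apply, TensorProduct.tmul_zero,
    map_zero]

theorem xPlus_zero_mul_loopPoly_matF (f : ℂ[X]) :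
    xPlus 0 * loopPoly matF f = loopPoly matF f * xPlus 0 + loopPoly matH f := by
  have h := loopPoly_mul_sub_mul matE matF 1 f
  rwa [lie_matE_matF, one_mul, loopPoly_one, sub_eq_iff_eq_add'] at h

theorem loopPoly_matH_mul_loopPoly_matF (f g : ℂ[X]) : loopPoly matH f * loopPoly matF g =
    loopPoly matF g * loopPoly matH f - (2 : ℂ) • loopPoly matF (f * g) := by
  have h := loopPoly_mul_sub_mul matH matF f g
  rwa [lie_matH_matF, loopPoly_smul_left, sub_eq_iff_eq_add', neg_smul, ← sub_eq_add_neg] at h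

/-- The elements `t f(t) ⊗ x⁻` of `U(B)`; the factor `t` excludes `x_0⁻`. -/
def borelF : ℂ[X] →ₗ[ℂ] UB :=
  (loopPoly matF ∘ₗ LinearMap.mulLeft ℂ Polynomial.X).codRestrict (Subalgebra.toSubmodule UB)
    loopPoly_matF_X_mul_mem

/-- The elements `f(t) ⊗ h` of `U(B)`. -/
def borelH : ℂ[X] →ₗ[ℂ] UB := (loopPoly matH).codRestrict (Subalgebra.toSubmodule UB)
  loopPoly_matH_mem

theorem coe_borelF (f : ℂ[X]) : (borelF f : ULoop) = loopPoly matF (Polynomial.X * f) := rfl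

theorem coe_borelH (f : ℂ[X]) : (borelH f : ULoop) = loopPoly matH f := rfl

/-- The triple of `x_0⁺`, `t f(t) ⊗ x⁻` and `f(t) ⊗ h` in `U(B)`. -/
def borelTriple : LoopTriple ℂ UB where
  e := bxPlus 0
  F := borelF
  H := borelH
  F_comm f g := Subtype.ext (loopPoly_matF_comm _ _)
  e_F f := Subtype.ext (xPlus_zero_mul_loopPoly_matF _)
  H_F f g := Subtype.ext <| by
    rw [UB.coe_sub, UB.coe_mul, UB.coe_mul, UB.coe_smul, coe_borelF, coe_borelF, coe_borelH,
      loopPoly_matH_mul_loopPoly_matF, mul_left_comm]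

theorem borelTriple_F_one : borelTriple.F 1 = bxMinusOne :=
  Subtype.ext <| (coe_borelF 1).trans <| by
    rw [mul_one, ← pow_one Polynomial.X, loopPoly_X_pow]
    rfl

theorem borelTriple_H_X_pow (n : ℕ) : borelTriple.H (Polynomial.X ^ n) = bh n :=
  Subtype.ext (loopPoly_X_pow matH n)

theorem xMinusParam_eq_loopPoly (A : Multiset ℂ) :
    xMinusParam A = loopPoly matF (A.map fun t => Polynomial.X - Polynomial.C t).prod := by
  rw [Multiset.prod_X_sub_X_eq_sum_esymm, map_sum, xMinusParam]
  refine sum_congr rfl fun k hk => ?_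
  have coeff_eq : (-1) ^ k * (Polynomial.C (A.esymm k) * Polynomial.X ^ (A.card - k)) =
      ((-1) ^ k * A.esymm k) • (Polynomial.X ^ (A.card - k) : ℂ[X]) := by
    rw [Polynomial.smul_eq_C_mul, map_mul, map_pow, map_neg, map_one, mul_assoc]
  rw [coeff_eq, map_smul, loopPoly_X_pow, Nat.cast_sub (mem_range_succ_iff.1 hk), xMinus]

theorem prod_map_paramsWithout {s : ℕ} (a : Fin s → ℂ) (j : Fin s) :
    ((paramsWithout a j).map fun t => Polynomial.X - Polynomial.C t).prod =
      Polynomial.X * nodal (univ.erase j) a := by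
  rw [paramsWithout, Multiset.map_cons, Multiset.prod_cons, map_zero, sub_zero, Multiset.map_map]
  rfl

theorem rhoMinus_eq_rho {s : ℕ} (a : Fin s → ℂ) (j : Fin s) :
    rhoMinus a j = borelTriple.rho a j :=
  Subtype.ext <| (xMinusParam_eq_loopPoly _).trans <|
    (congrArg _ (prod_map_paramsWithout a j)).trans (coe_borelF _).symm

theorem prod_ofFn_rhoMinus {s n : ℕ} (a : Fin s → ℂ) (j : Fin n ↪o Fin s) :
    (List.ofFn fun t => rhoMinus a (j t)).prod =
      borelTriple.rhoProd a (Set.powersetCard.ofFinEmbEquiv j) := by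
  have image_eq : (Set.powersetCard.ofFinEmbEquiv j : Finset (Fin s)) = (List.ofFn j).toFinset := by
    ext i
    simp [Set.powersetCard.ofFinEmbEquiv_apply, List.mem_ofFn]
  have list_eq : (List.ofFn fun t => rhoMinus a (j t)) = (List.ofFn j).map (borelTriple.rho a) := by
    simp only [rhoMinus_eq_rho, List.map_ofFn, Function.comp_def]
  rw [list_eq, image_eq]
  exact (noncommProd_toFinset _ _ _ (List.nodup_ofFn.2 j.injective)).symm

theorem adjoin_generators_eq_top :
    Algebra.adjoin ℂ {bh 0, bxPlus 0, bxMinusOne} = (⊤ : Subalgebra ℂ UB) := by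
  refine Eq.trans (congrArg _ (Set.ext fun x => ?_)) Algebra.adjoin_adjoin_coe_preimage
  simp only [Set.mem_insert_iff, Set.mem_singleton_iff, Subtype.ext_iff]
  rfl

end BorelTriple

open LoopTriple

section HighestWeightVector

/-- The linear functional on polynomials with value `d k` on `X ^ k`: the weight of a highest
weight vector on which `h_k` acts as `d k`. -/
def weightFunctional (d : ℕ → ℂ) : ℂ[X] →ₗ[ℂ] ℂ := (Polynomial.basisMonomials ℂ).constr ℂ d

theorem weightFunctional_X_pow (d : ℕ → ℂ) (n : ℕ) :
    weightFunctional d (Polynomial.X ^ n) = d n := by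
  rw [← Polynomial.monomial_one_right_eq_X_pow]
  exact (Polynomial.basisMonomials ℂ).constr_basis ℂ d n

variable {V : Type*} [AddCommGroup V] [Module ℂ V] [Module UB V] {Ψ : V}

theorem coeff_drinfeldPoly (Ψ : V) {r k : ℕ} (hk : k ≤ r) :
    (drinfeldPoly Ψ r).coeff k = (-1) ^ k * eigenvalue Ψ k := by
  have term : ∀ i, (Polynomial.C (eigenvalue Ψ i) * (-Polynomial.X) ^ i).coeff k =
      if k = i then (-1) ^ k * eigenvalue Ψ k else 0 := fun i => by
    rw [neg_pow, ← Polynomial.C_1, ← Polynomial.C_neg, ← Polynomial.C_pow, ← mul_assoc,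
      ← Polynomial.C_mul, Polynomial.coeff_C_mul_X_pow]
    split_ifs with h
    · rw [h, mul_comm]
    · rfl
  rw [drinfeldPoly, Polynomial.finsetSum_coeff, sum_congr rfl fun i _ => term i, sum_ite_eq,
    if_pos (mem_range_succ_iff.2 hk)]

variable [IsScalarTower ℂ UB V] {d : ℕ → ℂ}

theorem IsHighestWeightVector.isHighest (hΨ : IsHighestWeightVector d Ψ) :
    borelTriple.IsHighest (weightFunctional d) Ψ where
  e_smul := hΨ.xPlus_smul 0
  H_smul f := by
    induction f using Polynomial.induction_on' with
    | add p q hp hq => rw [map_add, add_smul, hp, hq, map_add, add_smul]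
    | monomial n c => rw [← mul_one c, ← smul_eq_mul, ← Polynomial.smul_monomial,
        Polynomial.monomial_one_right_eq_X_pow, map_smul, map_smul, smul_assoc,
        borelTriple_H_X_pow, hΨ.h_smul, weightFunctional_X_pow, smul_assoc]

theorem IsHighestWeightVector.dividedPow_mul_dividedPow_smul (hΨ : IsHighestWeightVector d Ψ)
    (k : ℕ) : (dividedPow (bxPlus 0) k * dividedPow bxMinusOne k) • Ψ =
      ((-1) ^ k * coeff k (weightSeries (weightFunctional d))) • Ψ := by
  have key := e_pow_smul_F_one_pow hΨ.isHighest 0 k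
  have hk : (k ! : ℂ) ≠ 0 := Nat.cast_ne_zero.2 k.factorial_ne_zero
  rw [descentSeries, pow_zero, one_mul, coeff_map, algebraMap_smul, zero_add, zero_add,
    Nat.one_ascFactorial, borelTriple_F_one] at key
  rw [dividedPow, dividedPow, smul_mul_smul_comm, smul_assoc, mul_smul (bxPlus 0 ^ k), ← mul_inv,
    inv_smul_eq_iff₀ (mul_ne_zero hk hk)]
  refine key.trans ?_
  rw [← Int.cast_smul_eq_zsmul ℂ, smul_smul, smul_smul]
  push_cast
  congr 1
  ring

theorem IsHighestWeightVector.eigenvalue_eq (hΨ : IsHighestWeightVector d Ψ) (k : ℕ) :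
    eigenvalue Ψ k = (-1) ^ k * coeff k (weightSeries (weightFunctional d)) := by
  have action := hΨ.dividedPow_mul_dividedPow_smul k
  have exists_eigenvalue : ∃ c : ℂ,
      (dividedPow (bxPlus 0) k * dividedPow bxMinusOne k) • Ψ = c • Ψ := ⟨_, action⟩
  rw [eigenvalue, dif_pos exists_eigenvalue]
  exact smul_left_injective ℂ hΨ.ne_zero (exists_eigenvalue.choose_spec.symm.trans action)

theorem IsHighestWeightVector.X_pow_dvd_weightSeries_sub_drinfeldPoly
    (hΨ : IsHighestWeightVector d Ψ) (r : ℕ) :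
    X ^ (r + 1) ∣ weightSeries (weightFunctional d) - (drinfeldPoly Ψ r : ℂ⟦X⟧) :=
  X_pow_dvd_iff.2 fun k hk => by
    rw [map_sub, Polynomial.coeff_coe, coeff_drinfeldPoly Ψ (Nat.le_of_lt_succ hk),
      hΨ.eigenvalue_eq, ← mul_assoc, ← mul_pow, neg_one_mul, neg_neg, one_pow, one_mul, sub_self]

theorem IsHighestWeightVector.X_pow_dvd_weightSeries_sub_prod (hΨ : IsHighestWeightVector d Ψ)
    {r : ℕ} {ι : Type*} [Fintype ι] {a : ι → ℂ}
    (h : drinfeldPoly Ψ r = ∏ i, (1 - Polynomial.C (a i) * Polynomial.X)) :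
    X ^ (r + 1) ∣ weightSeries (weightFunctional d) - ∏ i, (1 - C (a i) * X) := by
  have coe_prod : ((∏ i, (1 - Polynomial.C (a i) * Polynomial.X) : ℂ[X]) : ℂ⟦X⟧) =
      ∏ i, (1 - C (a i) * X) := by
    rw [← Polynomial.coeToPowerSeries.ringHom_apply, map_prod]
    simp only [map_sub, map_one, map_mul, Polynomial.coeToPowerSeries.ringHom_apply,
      Polynomial.coe_C, Polynomial.coe_X]
  rw [← coe_prod, ← h]
  exact hΨ.X_pow_dvd_weightSeries_sub_drinfeldPoly r

theorem VB_le_of_generators_smul_mem {W : Submodule ℂ V} (mem : Ψ ∈ W)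
    (hh : ∀ v ∈ W, bh 0 • v ∈ W) (hp : ∀ v ∈ W, bxPlus 0 • v ∈ W)
    (hm : ∀ v ∈ W, bxMinusOne • v ∈ W) : VB Ψ ≤ W := fun v hv => by
  obtain ⟨x, rfl⟩ := Submodule.mem_span_singleton.1 hv
  refine smul_mem_of_adjoin_eq_top adjoin_generators_eq_top ?_ x Ψ mem
  rintro _ (rfl | rfl | rfl)
  exacts [hh, hp, hm]

theorem smul_mem_VB (x : UB) : x • Ψ ∈ VB Ψ :=
  Submodule.smul_mem _ x (Submodule.mem_span_singleton_self Ψ)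

end HighestWeightVector

section DistinctParameters

variable {V : Type*} [AddCommGroup V] [Module ℂ V] [Module UB V] [IsScalarTower ℂ UB V] {Ψ : V}
  {d : ℕ → ℂ} {s : ℕ} {a : Fin s → ℂ}

theorem VB_eq_span_rhoProd (hΨ : IsHighestWeightVector d Ψ) (ha : Function.Injective a)
    (hev : borelTriple.IsEvaluatedAt a Ψ)
    (hsq : ∀ j, borelTriple.rho a j • borelTriple.rho a j • Ψ = 0) :
    VB Ψ = Submodule.span ℂ (Set.range (borelTriple.rhoProd a · • Ψ)) := by
  refine le_antisymm (VB_le_of_generators_smul_mem ?_ ?_ ?_ ?_)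
    (Submodule.span_le.2 (Set.range_subset_iff.2 fun S => smul_mem_VB _))
  · exact Submodule.subset_span ⟨∅, (congrArg (· • Ψ) rhoProd_empty).trans (one_smul _ _)⟩
  · rw [← borelTriple_H_X_pow]
    exact H_smul_mem_span_rhoProd (hΨ.isHighest.H_smul _) hev
  · exact e_smul_mem_span_rhoProd hΨ.isHighest ha hev hsq
  · rw [← borelTriple_F_one]
    exact F_smul_mem_span_rhoProd ha hev hsq 1

theorem sector_eq_span_rhoProd (hΨ : IsHighestWeightVector d Ψ) (ha : Function.Injective a)
    (hev : borelTriple.IsEvaluatedAt a Ψ)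
    (hsq : ∀ j, borelTriple.rho a j • borelTriple.rho a j • Ψ = 0)
    (hne : borelTriple.F 1 ^ Fintype.card (Fin s) • Ψ ≠ 0) (n : ℕ) :
    sector Ψ (d 0) n =
      Submodule.span ℂ ((borelTriple.rhoProd a · • Ψ) '' Set.powersetCard (Fin s) n) := by
  have H_one : borelTriple.H 1 = bh 0 := borelTriple_H_X_pow 0
  have hd : borelTriple.H 1 • Ψ = d 0 • Ψ := H_one ▸ hΨ.h_smul 0
  refine le_antisymm (fun v hv => ?_) (Submodule.span_le.2 ?_)
  · exact mem_span_rhoProd_powersetCard ha hev hsq hne hd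
      (VB_eq_span_rhoProd hΨ ha hev hsq ▸ hv.1) (H_one ▸ hv.2)
  · rintro _ ⟨S, rfl, rfl⟩
    refine ⟨smul_mem_VB _, ?_⟩
    rw [← H_one, H_smul_rhoProd_smul hd hev]
    simp only [Polynomial.eval_one, sum_const, nsmul_one]

theorem exists_basis_sector (hΨ : IsHighestWeightVector d Ψ) (ha : Function.Injective a)
    (hev : borelTriple.IsEvaluatedAt a Ψ)
    (hsq : ∀ j, borelTriple.rho a j • borelTriple.rho a j • Ψ = 0)
    (hne : borelTriple.F 1 ^ Fintype.card (Fin s) • Ψ ≠ 0) (n : ℕ) :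
    ∃ b : Module.Basis (Fin n ↪o Fin s) ℂ (sector Ψ (d 0) n),
      ∀ j, (b j : V) = (List.ofFn fun t => rhoMinus a (j t)).prod • Ψ := by
  have indep := (linearIndependent_rhoProd_smul ha hev hsq hne).comp
    (Subtype.val : Set.powersetCard (Fin s) n → Finset (Fin s)) Subtype.val_injective
  have span_eq : Submodule.span ℂ (Set.range ((borelTriple.rhoProd a · • Ψ) ∘
      (Subtype.val : Set.powersetCard (Fin s) n → Finset (Fin s)))) = sector Ψ (d 0) n := by
    rw [sector_eq_span_rhoProd hΨ ha hev hsq hne, Set.range_comp, Subtype.range_coe]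
  refine ⟨((Module.Basis.span indep).map (LinearEquiv.ofEq _ _ span_eq)).reindex
    Set.powersetCard.ofFinEmbEquiv.symm, fun j => ?_⟩
  rw [Module.Basis.reindex_apply, Module.Basis.map_apply, LinearEquiv.coe_ofEq_apply,
    Module.Basis.span_apply, prod_ofFn_rhoMinus]
  rfl

end DistinctParameters

end BorelLoop

end

theorem mainTheorem3_general {V : Type*} [AddCommGroup V] [Module ℂ V] [Module BorelLoop.UB V]
    [IsScalarTower ℂ BorelLoop.UB V] (Ψ : V) (d : ℕ → ℂ)
    (hΨ : BorelLoop.IsHighestWeightVector d Ψ)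
    (r : ℕ) (hr : BorelLoop.IsNilpotentOfDegree Ψ r)
    (s : ℕ) (a : Fin s → ℂ) (m : Fin s → ℕ)
    (ha : BorelLoop.IsEvaluationParameters Ψ r a m) (hdistinct : ∀ k, m k = 1) :
    FiniteDimensional ℂ (BorelLoop.VB Ψ) ∧
      ∀ n, ∃ b : Module.Basis (Fin n ↪o Fin s) ℂ (BorelLoop.sector Ψ (d 0) n),
        ∀ j : Fin n ↪o Fin s,
          (b j : V) = (List.ofFn fun t => BorelLoop.rhoMinus a (j t)).prod • Ψ := by
  obtain ⟨hinj, -, hsum, hfac⟩ := ha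
  simp only [hdistinct, pow_one] at hfac
  obtain rfl : Fintype.card (Fin s) = r := by
    simpa only [hdistinct, Finset.sum_const, Finset.card_univ, smul_eq_mul, mul_one] using hsum
  rw [BorelLoop.IsNilpotentOfDegree, ← BorelLoop.borelTriple_F_one] at hr
  have hne : BorelLoop.borelTriple.F 1 ^ Fintype.card (Fin s) • Ψ ≠ 0 := by
    rcases Nat.eq_zero_or_pos (Fintype.card (Fin s)) with hs | hs
    · rw [hs, pow_zero, one_smul]
      exact hΨ.ne_zero
    · exact hr.2 _ hs le_rfl
  have hδ := hΨ.X_pow_dvd_weightSeries_sub_prod hfac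
  have hev := BorelLoop.LoopTriple.isEvaluatedAt_of_F_one_pow_smul_eq_zero hΨ.isHighest hinj hr.1 hδ
  have hsq := BorelLoop.LoopTriple.rho_smul_rho_smul_eq_zero hΨ.isHighest hinj hr.1 hδ
  refine ⟨?_, BorelLoop.exists_basis_sector hΨ hinj hev hsq hne⟩
  rw [BorelLoop.VB_eq_span_rhoProd hΨ hinj hev hsq]
  exact .span_of_finite ℂ (Set.finite_range _)

theorem mainTheorem3 {V : Type*} [AddCommGroup V] [Module ℂ V] [Module BorelLoop.UB V]
    [IsScalarTower ℂ BorelLoop.UB V] (Ψ : V) (d : ℕ → ℂ)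
    (hΨ : BorelLoop.IsHighestWeightVector d Ψ)
    (hfin : FiniteDimensional ℂ (BorelLoop.VB Ψ))
    (r : ℕ) (hr : BorelLoop.IsNilpotentOfDegree Ψ r)
    (s : ℕ) (a : Fin s → ℂ) (m : Fin s → ℕ)
    (ha : BorelLoop.IsEvaluationParameters Ψ r a m)
    (hdistinct : ∀ k, m k = 1) (n : ℕ) :
    ∃ b : Module.Basis (Fin n ↪o Fin s) ℂ (BorelLoop.sector Ψ (d 0) n),
      ∀ j : Fin n ↪o Fin s,
        (b j : V) = (List.ofFn fun t => BorelLoop.rhoMinus a (j t)).prod • Ψ :=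
  (mainTheorem3_general Ψ d hΨ r hr s a m ha hdistinct).2 n
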